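/- Let $\mathbb H^n$ be the $n$-dimensional real hyperbolic space, with its distance $\mathrm d$ and Riemannian volume $\operatorname{Vol}$, and let $\mathcal K(\mathbb H^n)$ be the set of compact (geodesically) convex subsets of $\mathbb H^n$ with nonempty interior. For $K\in\mathcal K(\mathbb H^n)$ and $x\in\mathbb H^n\setminus K$ let $f_K(x)\in\partial K$ be the unique point of $K$ with $\mathrm d(f_K(x),x)=\mathrm d(x,K)$. For $\rho>0$ and a Borel set $\beta\subset\mathbb H^n$ put $$M_\rho(K,\beta)=\{x\in\mathbb H^n\setminus K:\ \mathrm d(x,K)\le\rho,\ f_K(x)\in\beta\cap\partial K\},\qquad \mu_\rho(K,\beta)=\operatorname{Vol}(M_\rho(K,\beta)),$$ so that $\mu_\rho(K,\cdot)$ is a finite Borel measure on $\mathbb H^n$. Let $(K_j)_{j\ge1}$ be a sequence in $\mathcal K(\mathbb H^n)$ and let $K\in\mathcal K(\mathbb H^n)$ be such that $K_j\to K$ as $j\to\infty$ with respect to the Hausdorff distance. Then, for every $\rho>0$, $$\mu_\rho(K_j,\cdot)\to\mu_\rho(K,\cdot)\qquad\text{as } j\to\infty$$ weakly in the sense of measures,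 that is, $\int g\,d\mu_\rho(K_j,\cdot)\to\int g\,d\mu_\rho(K,\cdot)$ for every bounded continuous function $g:\mathbb H^n\to\mathbb R$. -/

import Mathlib

open MeasureTheory Filter Topology
open scoped NNReal ENNReal

noncomputable section

/-- The `n`-dimensional real hyperbolic space (hyperboloid model): the upper sheet
`{(t, x) ∈ ℝ × ℝⁿ : t > 0, t² - |x|² = 1}` of the two-sheeted hyperboloid in Minkowski space. -/
@[ext]
structure HyperbolicSpace (n : ℕ) where
  time : ℝ
  space : EuclideanSpace ℝ (Fin n)
  time_pos : 0 < time
  sheet : time ^ 2 - ‖space‖ ^ 2 = 1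

namespace HyperbolicSpace

variable {n : ℕ}

/-- The negative of the Minkowski product of two points of the hyperboloid. -/
def form (p q : HyperbolicSpace n) : ℝ :=
  p.time * q.time - inner ℝ p.space q.space

lemma form_comm (p q : HyperbolicSpace n) : form p q = form q p := by
  unfold form
  rw [real_inner_comm, mul_comm]

lemma form_self (p : HyperbolicSpace n) : form p p = 1 := by
  unfold form
  rw [real_inner_self_eq_norm_sq, ← p.sheet]
  ring

/-- The Minkowski product is positive semidefinite on the orthogonal complement of a point of the
hyperboloid. -/
lemma sq_le_of_orthogonal (v : HyperbolicSpace n) (α : ℝ) (a : EuclideanSpace ℝ (Fin n))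
    (h : α * v.time = inner ℝ a v.space) : α ^ 2 ≤ ‖a‖ ^ 2 := by
  have h1 : (α * v.time) ^ 2 ≤ ‖a‖ ^ 2 * ‖v.space‖ ^ 2 := by
    rw [h, ← mul_pow]
    exact sq_le_sq' (neg_le_of_abs_le (abs_real_inner_le_norm a v.space))
      (le_of_abs_le (abs_real_inner_le_norm a v.space))
  have h2 := v.sheet
  have h3 : 0 < v.time ^ 2 := pow_pos v.time_pos 2
  have h4 : α ^ 2 * v.time ^ 2 ≤ ‖a‖ ^ 2 * v.time ^ 2 := by
    nlinarith [sq_nonneg ‖a‖]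
  exact le_of_mul_le_mul_right h4 h3

/-- The Cauchy-Schwarz inequality on the orthogonal complement of a point of the hyperboloid. -/
lemma cauchy_of_orthogonal (v : HyperbolicSpace n) (α β : ℝ) (a b : EuclideanSpace ℝ (Fin n))
    (ha : α * v.time = inner ℝ a v.space) (hb : β * v.time = inner ℝ b v.space) :
    (inner ℝ a b - α * β) ^ 2 ≤ (‖a‖ ^ 2 - α ^ 2) * (‖b‖ ^ 2 - β ^ 2) := by
  have key : ∀ r : ℝ, 0 ≤ (‖b‖ ^ 2 - β ^ 2) * (r * r) + (2 * (inner ℝ a b - α * β)) * r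
      + (‖a‖ ^ 2 - α ^ 2) := by
    intro r
    have h := sq_le_of_orthogonal v (α + r * β) (a + r • b) (by
      rw [inner_add_left, real_inner_smul_left, ← ha, ← hb]; ring)
    have e : ‖a + r • b‖ ^ 2 = ‖a‖ ^ 2 + 2 * (r * inner ℝ a b) + r ^ 2 * ‖b‖ ^ 2 := by
      rw [norm_add_sq_real, real_inner_smul_right, norm_smul, mul_pow, Real.norm_eq_abs, sq_abs]
    rw [e] at h
    nlinarith
  have := discrim_le_zero key
  unfold discrim at this
  nlinarith

lemma form_le (u v w : HyperbolicSpace n) :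
    (form u w - form u v * form v w) ^ 2 ≤ (form u v ^ 2 - 1) * (form v w ^ 2 - 1) := by
  have hu := u.sheet
  have hv := v.sheet
  have hw := w.sheet
  have h := cauchy_of_orthogonal v (u.time - form u v * v.time) (w.time - form v w * v.time)
    (u.space - form u v • v.space) (w.space - form v w • v.space)
    (by
      rw [inner_sub_left, real_inner_smul_left, real_inner_self_eq_norm_sq]
      have : inner ℝ u.space v.space = u.time * v.time - form u v := by unfold form; ring
      rw [this]; linear_combination (-form u v) * hv)
    (by
      rw [inner_sub_left, real_inner_smul_left, real_inner_self_eq_norm_sq]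
      have : inner ℝ w.space v.space = v.time * w.time - form v w := by
        unfold form; rw [real_inner_comm]; ring
      rw [this]; linear_combination (-form v w) * hv)
  have e1 : inner ℝ u.space v.space = u.time * v.time - form u v := by unfold form; ring
  have e2 : inner ℝ v.space w.space = v.time * w.time - form v w := by unfold form; ring
  have e3 : inner ℝ u.space w.space = u.time * w.time - form u w := by unfold form; ring
  have e2' : inner ℝ w.space v.space = v.time * w.time - form v w := by
    rw [real_inner_comm]; exact e2
  have f1 : inner ℝ (u.space - form u v • v.space) (w.space - form v w • v.space)
      - (u.time - form u v * v.time) * (w.time - form v w * v.time)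
      = form u v * form v w - form u w := by
    simp only [inner_sub_left, inner_sub_right, real_inner_smul_left, real_inner_smul_right,
      real_inner_self_eq_norm_sq, e1, e2, e3]
    linear_combination (-form u v * form v w) * hv
  have f2 : ‖u.space - form u v • v.space‖ ^ 2 - (u.time - form u v * v.time) ^ 2
      = form u v ^ 2 - 1 := by
    rw [norm_sub_sq_real, real_inner_smul_right, norm_smul, mul_pow, Real.norm_eq_abs, sq_abs, e1]
    linear_combination (-1) * hu - form u v ^ 2 * hv
  have f3 : ‖w.space - form v w • v.space‖ ^ 2 - (w.time - form v w * v.time) ^ 2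
      = form v w ^ 2 - 1 := by
    rw [norm_sub_sq_real, real_inner_smul_right, norm_smul, mul_pow, Real.norm_eq_abs, sq_abs, e2']
    linear_combination (-1) * hw - form v w ^ 2 * hv
  rw [f1, f2, f3] at h
  nlinarith

lemma norm_lt_time (p : HyperbolicSpace n) : ‖p.space‖ < p.time := by
  have h := p.sheet
  have := p.time_pos
  nlinarith [norm_nonneg p.space]

lemma form_pos (p q : HyperbolicSpace n) : 0 < form p q := by
  unfold form
  have h1 := real_inner_le_norm p.space q.space
  have h2 := norm_lt_time p
  have h3 := norm_lt_time q
  have : ‖p.space‖ * ‖q.space‖ < p.time * q.time :=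
    mul_lt_mul'' h2 h3 (norm_nonneg _) (norm_nonneg _)
  linarith

lemma one_le_form (p q : HyperbolicSpace n) : 1 ≤ form p q := by
  have hp := p.sheet
  have hq := q.sheet
  have h1 := real_inner_le_norm p.space q.space
  have h2 : 1 + ‖p.space‖ * ‖q.space‖ ≤ p.time * q.time := by
    refine (sq_le_sq₀ (by positivity) (mul_pos p.time_pos q.time_pos).le).1 ?_
    have e : (p.time * q.time) ^ 2 = (1 + ‖p.space‖ ^ 2) * (1 + ‖q.space‖ ^ 2) := by
      rw [mul_pow]
      congr 1 <;> linarith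
    rw [e]
    nlinarith [sq_nonneg (‖p.space‖ - ‖q.space‖)]
  unfold form
  linarith

/-- The hyperbolic distance, determined by `cosh d(p, q) = t s - ⟪x, y⟫` for `p = (t, x)` and
`q = (s, y)`. -/
instance : Dist (HyperbolicSpace n) := ⟨fun p q => Real.arcosh (form p q)⟩

lemma dist_def (p q : HyperbolicSpace n) : dist p q = Real.arcosh (form p q) := rfl

lemma cosh_dist (p q : HyperbolicSpace n) : Real.cosh (dist p q) = form p q :=
  Real.cosh_arcosh (one_le_form p q)

lemma dist_nonneg_aux (p q : HyperbolicSpace n) : 0 ≤ dist p q :=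
  Real.arcosh_nonneg (one_le_form p q)

lemma dist_triangle_aux (u v w : HyperbolicSpace n) : dist u w ≤ dist u v + dist v w := by
  have h0 := dist_nonneg_aux u v
  have h1 := dist_nonneg_aux v w
  have h2 := dist_nonneg_aux u w
  rw [← abs_of_nonneg h2, ← abs_of_nonneg (add_nonneg h0 h1), ← Real.cosh_le_cosh, Real.cosh_add]
  have h := form_le u v w
  rw [← cosh_dist u v, ← cosh_dist v w, ← cosh_dist u w, ← Real.sinh_sq, ← Real.sinh_sq,
    ← mul_pow] at h
  have := abs_le_of_sq_le_sq h (mul_nonneg (Real.sinh_nonneg_iff.2 h0) (Real.sinh_nonneg_iff.2 h1))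
  linarith [le_of_abs_le this]

lemma eq_of_form_eq_one {p q : HyperbolicSpace n} (h : form p q = 1) : p = q := by
  have hp := p.sheet
  have hq := q.sheet
  have e : inner ℝ p.space q.space = p.time * q.time - 1 := by rw [← h]; unfold form; ring
  -- `p - q` is lightlike, and its positive part along `p` vanishes
  have o := sq_le_of_orthogonal p (q.time - p.time) (q.space - p.space) (by
    rw [inner_sub_left, real_inner_comm, e, real_inner_self_eq_norm_sq]
    linear_combination (-1) * hp)
  have e2 : ‖q.space - p.space‖ ^ 2 = (q.time - p.time) ^ 2 := by
    rw [norm_sub_sq_real, real_inner_comm, e]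
    linear_combination (-1) * hp - hq
  have e3 : (q.time - p.time) * p.time = inner ℝ (q.space - p.space) p.space := by
    rw [inner_sub_left, real_inner_comm, e, real_inner_self_eq_norm_sq]
    linear_combination (-1) * hp
  have e4 : ((q.time - p.time) * p.time) ^ 2 ≤ (q.time - p.time) ^ 2 * ‖p.space‖ ^ 2 := by
    rw [e3, ← e2, ← mul_pow]
    exact sq_le_sq' (neg_le_of_abs_le (abs_real_inner_le_norm _ _))
      (le_of_abs_le (abs_real_inner_le_norm _ _))
  have e5 : (q.time - p.time) ^ 2 = 0 := by nlinarith [sq_nonneg (q.time - p.time)]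
  have e6 : ‖q.space - p.space‖ ^ 2 = 0 := e2.trans e5
  have e7 : q.space - p.space = 0 := by simpa using e6
  have e8 : q.time - p.time = 0 := by simpa using e5
  exact HyperbolicSpace.ext (by linarith) (sub_eq_zero.1 e7).symm

instance : MetricSpace (HyperbolicSpace n) where
  dist_self p := by rw [dist_def, form_self]; simp
  dist_comm p q := by rw [dist_def, dist_def, form_comm]
  dist_triangle := dist_triangle_aux
  eq_of_dist_eq_zero {p q} h := by
    apply eq_of_form_eq_one
    rw [← cosh_dist, h, Real.cosh_zero]

instance : MeasurableSpace (HyperbolicSpace n) := borel _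

instance : BorelSpace (HyperbolicSpace n) := ⟨rfl⟩

/-- The global chart of the hyperboloid, as the graph of `x ↦ √(1 + |x|²)`. -/
def ofSpace (x : EuclideanSpace ℝ (Fin n)) : HyperbolicSpace n where
  time := √(1 + ‖x‖ ^ 2)
  space := x
  time_pos := by positivity
  sheet := by rw [Real.sq_sqrt (by positivity)]; ring

lemma ofSpace_space (p : HyperbolicSpace n) : ofSpace p.space = p := by
  refine HyperbolicSpace.ext ?_ rfl
  have : 1 + ‖p.space‖ ^ 2 = p.time ^ 2 := by linarith [p.sheet]
  simp only [ofSpace, this, Real.sqrt_sq p.time_pos.le]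

lemma continuous_ofSpace : Continuous (ofSpace : EuclideanSpace ℝ (Fin n) → HyperbolicSpace n) := by
  rw [continuous_iff_continuous_dist]
  simp only [dist_def, Real.arcosh]
  refine Continuous.log ?_ ?_
  · unfold form ofSpace
    fun_prop
  · intro x
    have := form_pos (ofSpace x.1) (ofSpace x.2)
    positivity

/-- The matrix, in the chart `ofSpace`, of the Riemannian metric that the Minkowski metric
`dx² - dt²` induces on the hyperboloid `t = √(1 + |x|²)`: since `dt = ⟪x, dx⟫ / √(1 + |x|²)`,
it is `δᵢⱼ - xᵢ xⱼ / (1 + |x|²)`. -/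
def metricMatrix (x : EuclideanSpace ℝ (Fin n)) : Matrix (Fin n) (Fin n) ℝ :=
  Matrix.of fun i j => (if i = j then 1 else 0) - x i * x j / (1 + ‖x‖ ^ 2)

lemma det_metricMatrix (x : EuclideanSpace ℝ (Fin n)) :
    (metricMatrix x).det = (1 + ‖x‖ ^ 2)⁻¹ := by
  have h : metricMatrix x = 1 + Matrix.replicateCol Unit (fun i => -(x i / (1 + ‖x‖ ^ 2))) *
      Matrix.replicateRow Unit (fun i => x i) := by
    ext i j
    simp only [metricMatrix, Matrix.of_apply, Matrix.add_apply, Matrix.one_apply,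
      Matrix.mul_apply, Matrix.replicateCol_apply, Matrix.replicateRow_apply, Finset.sum_const,
      Finset.card_univ, Fintype.card_unit, one_smul]
    ring
  have hs : ∑ i, x i * x i = ‖x‖ ^ 2 := by
    rw [EuclideanSpace.real_norm_sq_eq]
    exact Finset.sum_congr rfl fun i _ => (sq _).symm
  have hpos : (1 + ‖x‖ ^ 2) ≠ 0 := by positivity
  rw [h, Matrix.det_one_add_replicateCol_mul_replicateRow]
  have : (fun i => x i) ⬝ᵥ (fun i => -(x i / (1 + ‖x‖ ^ 2))) = -(‖x‖ ^ 2 / (1 + ‖x‖ ^ 2)) := by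
    simp only [dotProduct, mul_neg, Finset.sum_neg_distrib, ← mul_div_assoc, ← Finset.sum_div, hs]
  rw [this]
  field_simp
  ring

/-- The Riemannian volume measure `√(det g) dx` of hyperbolic space. -/
def vol (n : ℕ) : Measure (HyperbolicSpace n) :=
  ((volume : Measure (EuclideanSpace ℝ (Fin n))).withDensity
    fun x => ENNReal.ofReal √(metricMatrix x).det).map ofSpace

lemma vol_lt_top_of_isBounded {S : Set (HyperbolicSpace n)} (hS : Bornology.IsBounded S) :
    vol n S < ∞ := by
  obtain ⟨R, hR⟩ := hS.subset_closedBall (ofSpace 0)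
  refine (measure_mono hR).trans_lt ?_
  have hm : MeasurableSet (Metric.closedBall (ofSpace (0 : EuclideanSpace ℝ (Fin n))) R) :=
    Metric.isClosed_closedBall.measurableSet
  unfold vol
  rw [Measure.map_apply continuous_ofSpace.measurable hm,
    withDensity_apply _ (continuous_ofSpace.measurable hm)]
  have hsub : ofSpace ⁻¹' Metric.closedBall (ofSpace (0 : EuclideanSpace ℝ (Fin n))) R
      ⊆ Metric.closedBall 0 (Real.cosh R) := by
    intro x hx
    have h1 : dist (ofSpace x) (ofSpace 0) ≤ R := hx
    have h2 : Real.cosh (dist (ofSpace x) (ofSpace 0)) ≤ Real.cosh R := by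
      rw [Real.cosh_le_cosh, abs_of_nonneg dist_nonneg]
      exact h1.trans (le_abs_self R)
    rw [cosh_dist] at h2
    have h3 : form (ofSpace x) (ofSpace 0) = (ofSpace x).time := by simp [form, ofSpace]
    have h4 : ‖x‖ < (ofSpace x).time := norm_lt_time (ofSpace x)
    rw [mem_closedBall_zero_iff]
    linarith
  calc ∫⁻ x in ofSpace ⁻¹' Metric.closedBall (ofSpace (0 : EuclideanSpace ℝ (Fin n))) R,
        ENNReal.ofReal √(metricMatrix x).det
      ≤ ∫⁻ _ in ofSpace ⁻¹' Metric.closedBall (ofSpace (0 : EuclideanSpace ℝ (Fin n))) R, 1 := by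
        refine lintegral_mono fun x => ?_
        rw [det_metricMatrix]
        refine ENNReal.ofReal_le_one.2 (Real.sqrt_le_one.2 (inv_le_one_of_one_le₀ ?_))
        linarith [sq_nonneg ‖x‖]
    _ = volume (ofSpace ⁻¹' Metric.closedBall (ofSpace (0 : EuclideanSpace ℝ (Fin n))) R) := by simp
    _ ≤ volume (Metric.closedBall (0 : EuclideanSpace ℝ (Fin n)) (Real.cosh R)) := measure_mono hsub
    _ < ∞ := measure_closedBall_lt_top

/-- Geodesic convexity: with any two points `p, q`, the set contains the geodesic segment from
`p` to `q`, which in hyperbolic space is the set of all `z` with `d(p, z) + d(z, q) = d(p, q)`. -/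
def GeodesicallyConvex (S : Set (HyperbolicSpace n)) : Prop :=
  ∀ ⦃p⦄, p ∈ S → ∀ ⦃q⦄, q ∈ S → ∀ z, dist p z + dist z q = dist p q → z ∈ S

/-- The midpoint of the geodesic segment from `p` to `q`. -/
def midpt (p q : HyperbolicSpace n) : HyperbolicSpace n where
  time := (√(2 + 2 * form p q))⁻¹ * (p.time + q.time)
  space := (√(2 + 2 * form p q))⁻¹ • (p.space + q.space)
  time_pos := by
    have := form_pos p q
    have := p.time_pos
    have := q.time_pos
    positivity
  sheet := by
    have h := form_pos p q
    have hp := p.sheet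
    have hq := q.sheet
    have e : inner ℝ p.space q.space = p.time * q.time - form p q := by unfold form; ring
    rw [norm_smul, mul_pow, mul_pow, Real.norm_eq_abs, sq_abs, inv_pow,
      Real.sq_sqrt (by positivity), norm_add_sq_real, e, ← mul_sub]
    rw [inv_mul_eq_one₀ (by positivity)]
    linear_combination (-1) * hp - hq

lemma form_midpt (x p q : HyperbolicSpace n) :
    form x (midpt p q) = (√(2 + 2 * form p q))⁻¹ * (form x p + form x q) := by
  simp only [form, midpt, real_inner_smul_right, inner_add_right]
  ring

lemma dist_midpt_left (p q : HyperbolicSpace n) : dist p (midpt p q) = dist p q / 2 := by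
  have h := form_pos p q
  have hd : 0 ≤ dist p q / 2 := by positivity
  have e : Real.cosh (dist p (midpt p q)) = Real.cosh (dist p q / 2) := by
    have h2 : Real.cosh (dist p q) = 2 * Real.cosh (dist p q / 2) ^ 2 - 1 := by
      have h3 := Real.cosh_two_mul (dist p q / 2)
      have h4 := Real.cosh_sq (dist p q / 2)
      rw [mul_div_cancel₀ _ (two_ne_zero)] at h3
      linarith
    rw [cosh_dist p q] at h2
    have hc : 0 < Real.cosh (dist p q / 2) := Real.cosh_pos _
    rw [cosh_dist, form_midpt, form_self, h2]
    have : 2 + 2 * (2 * Real.cosh (dist p q / 2) ^ 2 - 1) = (2 * Real.cosh (dist p q / 2)) ^ 2 := by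
      ring
    rw [this, Real.sqrt_sq (by positivity)]
    field_simp
    ring
  have := Real.cosh_injOn (x₁ := dist p (midpt p q)) (x₂ := dist p q / 2) dist_nonneg hd e
  exact this

lemma midpt_comm (p q : HyperbolicSpace n) : midpt p q = midpt q p := by
  ext
  · simp only [midpt, form_comm p q, add_comm]
  · simp only [midpt, form_comm p q, add_comm]

lemma dist_midpt_right (p q : HyperbolicSpace n) : dist (midpt p q) q = dist p q / 2 := by
  rw [dist_comm, midpt_comm, dist_midpt_left, dist_comm]

lemma dist_midpt_lt {x p q : HyperbolicSpace n} (hpq : p ≠ q) (h : dist x p = dist x q) :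
    dist x (midpt p q) < dist x p := by
  have hf : 1 < form p q :=
    lt_of_le_of_ne (one_le_form p q) fun e => hpq (eq_of_form_eq_one e.symm)
  have he : form x q = form x p := by rw [← cosh_dist, ← cosh_dist, h]
  have hx := form_pos x p
  rw [← abs_of_nonneg (dist_nonneg (x := x) (y := midpt p q)),
    ← abs_of_nonneg (dist_nonneg (x := x) (y := p)), ← Real.cosh_lt_cosh, cosh_dist, cosh_dist,
    form_midpt, he]
  have h2 : 2 < √(2 + 2 * form p q) := by
    rw [Real.lt_sqrt (by norm_num)]
    linarith
  rw [inv_mul_lt_iff₀ (by positivity)]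
  nlinarith

end HyperbolicSpace

open HyperbolicSpace

/-- A compact convex subset of hyperbolic space with nonempty interior. -/
structure HypConvexBody (n : ℕ) where
  carrier : Set (HyperbolicSpace n)
  isCompact : IsCompact carrier
  convex : GeodesicallyConvex carrier
  interior_nonempty : (interior carrier).Nonempty

namespace HypConvexBody

variable {n : ℕ} (K : HypConvexBody n)

lemma nonempty : K.carrier.Nonempty := K.interior_nonempty.mono interior_subset

lemma existsUnique_nearest (x : HyperbolicSpace n) :
    ∃! y, y ∈ K.carrier ∧ dist y x = Metric.infDist x K.carrier := by
  obtain ⟨y, hy, hxy⟩ := K.isCompact.exists_infDist_eq_dist K.nonempty x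
  refine ⟨y, ⟨hy, by rw [hxy, dist_comm]⟩, ?_⟩
  rintro z ⟨hz, hzx⟩
  by_contra hne
  have hm : midpt z y ∈ K.carrier :=
    K.convex hz hy _ (by rw [dist_midpt_left, dist_midpt_right]; ring)
  have h1 := dist_midpt_lt (x := x) hne (by rw [dist_comm x z, hzx, hxy])
  have h2 := Metric.infDist_le_dist_of_mem (x := x) hm
  rw [dist_comm x z, hzx] at h1
  linarith

/-- The nearest-point projection: the unique point of `K` at minimal distance from `x`. -/
def proj (x : HyperbolicSpace n) : HyperbolicSpace n := (K.existsUnique_nearest x).choose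

lemma proj_mem (x : HyperbolicSpace n) : K.proj x ∈ K.carrier :=
  (K.existsUnique_nearest x).choose_spec.1.1

lemma dist_proj (x : HyperbolicSpace n) : dist (K.proj x) x = Metric.infDist x K.carrier :=
  (K.existsUnique_nearest x).choose_spec.1.2

lemma eq_proj {x y : HyperbolicSpace n} (hy : y ∈ K.carrier)
    (h : dist y x = Metric.infDist x K.carrier) : y = K.proj x :=
  (K.existsUnique_nearest x).choose_spec.2 y ⟨hy, h⟩

lemma continuous_proj : Continuous K.proj := by
  rw [continuous_iff_isClosed]
  intro C hC
  rcases (C ∩ K.carrier).eq_empty_or_nonempty with he | hne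
  · have : K.proj ⁻¹' C = ∅ := by
      ext x
      simp only [Set.mem_preimage, Set.mem_empty_iff_false, iff_false]
      intro hx
      have : K.proj x ∈ C ∩ K.carrier := ⟨hx, K.proj_mem x⟩
      simp [he] at this
    rw [this]
    exact isClosed_empty
  · have : K.proj ⁻¹' C
        = {x | Metric.infDist x (C ∩ K.carrier) = Metric.infDist x K.carrier} := by
      ext x
      simp only [Set.mem_preimage, Set.mem_ofPred_eq]
      constructor
      · intro hx
        refine le_antisymm ?_ (Metric.infDist_le_infDist_of_subset Set.inter_subset_right hne)
        rw [← K.dist_proj, dist_comm]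
        exact Metric.infDist_le_dist_of_mem ⟨hx, K.proj_mem x⟩
      · intro hx
        obtain ⟨y, hy, hxy⟩ := (K.isCompact.inter_left hC).exists_infDist_eq_dist hne x
        rw [← K.eq_proj hy.2 (by rw [dist_comm, ← hxy, hx])]
        exact hy.1
    rw [this]
    exact isClosed_eq (Metric.continuous_infDist_pt _) (Metric.continuous_infDist_pt _)

/-- The local parallel set: the points outside `K`, at distance at most `ρ` from `K`, whose nearest
point in `K` lies in `β ∩ ∂K`. -/
def localParallelSet (ρ : ℝ) (β : Set (HyperbolicSpace n)) : Set (HyperbolicSpace n) :=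
  K.proj ⁻¹' (β ∩ frontier K.carrier) ∩ ({x | Metric.infDist x K.carrier ≤ ρ} \ K.carrier)

lemma measurableSet_localParallelSet (ρ : ℝ) {β : Set (HyperbolicSpace n)}
    (hβ : MeasurableSet β) : MeasurableSet (K.localParallelSet ρ β) :=
  (K.continuous_proj.measurable (hβ.inter isClosed_frontier.measurableSet)).inter
    ((isClosed_le (Metric.continuous_infDist_pt _) continuous_const).measurableSet.diff
      K.isCompact.isClosed.measurableSet)

/-- The local parallel volume as a Borel measure: `β ↦ Vol (M_ρ(K, β))`, where `M_ρ(K, β)` is the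
local parallel set. -/
def parallelMeasure (ρ : ℝ) : Measure (HyperbolicSpace n) :=
  Measure.ofMeasurable (fun β _ => vol n (K.localParallelSet ρ β))
    (by simp [localParallelSet])
    (by
      intro f hf hd
      have : K.localParallelSet ρ (⋃ i, f i) = ⋃ i, K.localParallelSet ρ (f i) := by
        simp only [localParallelSet, Set.iUnion_inter, Set.preimage_iUnion]
      rw [this]
      refine measure_iUnion ?_ fun i => K.measurableSet_localParallelSet ρ (hf i)
      intro i j hij
      refine Set.disjoint_left.2 fun x hx hx' => ?_
      exact Set.disjoint_left.1 (hd hij) hx.1.1 hx'.1.1)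

lemma parallelMeasure_apply (ρ : ℝ) {β : Set (HyperbolicSpace n)} (hβ : MeasurableSet β) :
    K.parallelMeasure ρ β = vol n (K.localParallelSet ρ β) :=
  Measure.ofMeasurable_apply β hβ

instance isFiniteMeasure_parallelMeasure (ρ : ℝ) : IsFiniteMeasure (K.parallelMeasure ρ) := by
  refine ⟨?_⟩
  rw [K.parallelMeasure_apply ρ MeasurableSet.univ]
  refine vol_lt_top_of_isBounded ((K.isCompact.isBounded.cthickening (δ := ρ)).subset ?_)
  rintro x ⟨-, hx, -⟩
  exact Metric.mem_cthickening_of_dist_le x (K.proj x) ρ _ (K.proj_mem x)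
    (by rw [dist_comm, K.dist_proj]; exact hx)

/-- The finite Borel measure `μ_ρ(K, ·)`, as a point of the space of finite measures, whose topology
is that of weak convergence (testing against bounded continuous functions). -/
def mu (ρ : ℝ) : FiniteMeasure (HyperbolicSpace n) := ⟨K.parallelMeasure ρ, inferInstance⟩

end HypConvexBody

end

/-!
Since the nearest point of `K` to a point outside `K` lies on `∂K`, the measure `μ_ρ(K, ·)` is the
image, under the nearest-point projection, of the volume restricted to the shell
`{0 < d(·, K) ≤ ρ}` (`HypConvexBody.parallelMeasure_eq_map`). So `∫ g dμ_ρ(K, ·)` is the integral of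
`g ∘ proj` over the shell, and the theorem follows by dominated convergence once the integrands
converge almost everywhere.

Everything rests on the obtuse angle property of the projection,
`cosh d(x, w) ≥ cosh d(x, proj x) * cosh d(proj x, w)` for `w ∈ K`
(`HypConvexBody.form_proj_mul_form_le`). It gives the pointwise convergence of the projections
(`HypConvexBody.tendsto_proj`). It also shows that prolonging the geodesic from `proj x` to `x`
beyond `x` increases the distance to `K` at unit speed
(`HypConvexBody.exists_dist_eq_add_le_infDist`); hence an interior point of the limit body belongs to
all late bodies of the sequence (`HypConvexBody.eventually_mem_of_mem_interior`), since otherwise a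
point of the limit body near it would be too far from them.

The integrands therefore converge at `x` unless `x ∈ ∂K₀` or `d(x, K₀) = ρ`. The second set lies in
the boundary of the parallel body `{d(·, K₀) ≤ ρ}`, which is convex
(`HypConvexBody.infDist_le_of_isComb`): along the hyperboloid the signed distance to a hyperplane is,
up to `sinh`, the restriction of a linear functional. Boundaries of convex sets are null
(`HyperbolicSpace.vol_frontier_eq_zero`), because the Klein model maps convex sets to Euclidean
convex sets.
-/

namespace HyperbolicSpace

variable {n : ℕ}

/-! ### Geodesics as linear combinations -/

/-- `z = α p + β q` as vectors of Minkowski space. For `α, β ≥ 0` this says that `z` lies on the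
geodesic segment from `p` to `q`; negative coefficients reach the rest of the geodesic line. -/
def IsComb (α β : ℝ) (p q z : HyperbolicSpace n) : Prop :=
  z.time = α * p.time + β * q.time ∧ z.space = α • p.space + β • q.space

lemma IsComb.form_left {α β : ℝ} {p q z : HyperbolicSpace n} (h : IsComb α β p q z)
    (w : HyperbolicSpace n) : form z w = α * form p w + β * form q w := by
  unfold form
  rw [h.1, h.2, inner_add_left, real_inner_smul_left, real_inner_smul_left]
  ring

lemma IsComb.form_right {α β : ℝ} {p q z : HyperbolicSpace n} (h : IsComb α β p q z)
    (w : HyperbolicSpace n) : form w z = α * form w p + β * form w q := by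
  rw [form_comm, h.form_left, form_comm p, form_comm q]

lemma IsComb.sq_eq_one {α β : ℝ} {p q z : HyperbolicSpace n} (h : IsComb α β p q z) :
    α ^ 2 + β ^ 2 + 2 * α * β * form p q = 1 := by
  have h1 := form_self z
  rw [h.form_left, h.form_right, h.form_right, form_self, form_self, form_comm q p] at h1
  linarith

lemma IsComb.add_le_one {α β : ℝ} {p q z : HyperbolicSpace n} (h : IsComb α β p q z)
    (hα : 0 ≤ α) (hβ : 0 ≤ β) : α + β ≤ 1 := by
  have h1 := h.sq_eq_one
  have h2 := one_le_form p q
  have h3 : α * β * 1 ≤ α * β * form p q := by gcongr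
  nlinarith

/-- A unit combination of `p` and `q` is a point of the upper sheet as soon as its Minkowski product
with `p`, which is `α + β * form p q`, has the right sign. -/
lemma exists_isComb {α β : ℝ} {p q : HyperbolicSpace n}
    (h : α ^ 2 + β ^ 2 + 2 * α * β * form p q = 1) (hpos : 0 < α + β * form p q) :
    ∃ z, IsComb α β p q z := by
  set t := α * p.time + β * q.time with ht
  set v := α • p.space + β • q.space with hv
  have e : inner ℝ p.space q.space = p.time * q.time - form p q := by unfold form; ring
  have hsheet : t ^ 2 - ‖v‖ ^ 2 = 1 := by
    rw [hv, norm_add_sq_real, norm_smul, norm_smul, real_inner_smul_left, real_inner_smul_right, e,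
      mul_pow, mul_pow, Real.norm_eq_abs, Real.norm_eq_abs, sq_abs, sq_abs, ht]
    linear_combination h + α ^ 2 * p.sheet + β ^ 2 * q.sheet
  have hform : α + β * form p q = p.time * t - inner ℝ p.space v := by
    rw [hv, inner_add_right, real_inner_smul_right, real_inner_smul_right, e,
      real_inner_self_eq_norm_sq, ht]
    linear_combination (-α) * p.sheet
  have htpos : 0 < t := by
    by_contra hneg
    push Not at hneg
    have h1 := abs_le.1 (abs_real_inner_le_norm p.space v)
    have h2 : ‖v‖ ≤ -t := abs_le_of_sq_le_sq' (by nlinarith) (by linarith) |>.2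
    have h3 := norm_lt_time p
    have h4 : ‖p.space‖ * ‖v‖ ≤ p.time * (-t) := by
      gcongr
      exact p.time_pos.le
    linarith [h1.1]
  exact ⟨⟨t, v, htpos, hsheet⟩, rfl, rfl⟩

lemma dist_add_dist_of_isComb {α β : ℝ} {p q z : HyperbolicSpace n} (h : IsComb α β p q z)
    (hα : 0 ≤ α) (hβ : 0 ≤ β) : dist p z + dist z q = dist p q := by
  have h1 := h.sq_eq_one
  have hk := cosh_dist p q
  have hs := Real.cosh_sq (dist p q)
  have hs0 : 0 ≤ Real.sinh (dist p q) := Real.sinh_nonneg_iff.2 dist_nonneg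
  have ca : Real.cosh (dist p z) = α + β * form p q := by
    rw [cosh_dist, h.form_right, form_self, mul_one]
  have cb : Real.cosh (dist z q) = α * form p q + β := by
    rw [cosh_dist, h.form_left, form_self, mul_one]
  have sa : Real.sinh (dist p z) = β * Real.sinh (dist p q) := by
    refine (sq_eq_sq₀ (Real.sinh_nonneg_iff.2 dist_nonneg) (by positivity)).1 ?_
    rw [Real.sinh_sq, ca, mul_pow, Real.sinh_sq, hk]
    linear_combination h1
  have sb : Real.sinh (dist z q) = α * Real.sinh (dist p q) := by
    refine (sq_eq_sq₀ (Real.sinh_nonneg_iff.2 dist_nonneg) (by positivity)).1 ?_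
    rw [Real.sinh_sq, cb, mul_pow, Real.sinh_sq, hk]
    linear_combination h1
  refine Real.cosh_injOn (Set.mem_Ici.2 (by positivity)) (Set.mem_Ici.2 dist_nonneg) ?_
  rw [Real.cosh_add, ca, cb, sa, sb, hk]
  rw [hk] at hs
  linear_combination form p q * h1 - α * β * hs

lemma GeodesicallyConvex.mem_of_isComb {S : Set (HyperbolicSpace n)} (hS : GeodesicallyConvex S)
    {α β : ℝ} {p q z : HyperbolicSpace n} (hp : p ∈ S) (hq : q ∈ S) (h : IsComb α β p q z)
    (hα : 0 ≤ α) (hβ : 0 ≤ β) : z ∈ S :=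
  hS hp hq z (dist_add_dist_of_isComb h hα hβ)

/-- The geodesic from `y` to `x` can be prolonged beyond `x` by any length `r`. -/
lemma exists_prolongation {x y : HyperbolicSpace n} (hxy : x ≠ y) {r : ℝ} (hr : 0 ≤ r) :
    ∃ z α β, 0 ≤ α ∧ IsComb α β x y z ∧ dist z x = r ∧ dist z y = dist x y + r := by
  set d := dist x y with hd
  have hd0 : 0 < d := dist_pos.2 hxy
  have hs : 0 < Real.sinh d := Real.sinh_pos_iff.2 hd0
  have hc : form x y = Real.cosh d := (cosh_dist x y).symm
  have h1 := Real.cosh_sq d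
  have h2 := Real.cosh_sq r
  have e1 : Real.sinh (d + r) / Real.sinh d + -(Real.sinh r / Real.sinh d) * form x y
      = Real.cosh r := by
    rw [hc, Real.sinh_add]
    field_simp
    ring
  obtain ⟨z, hz⟩ := exists_isComb (p := x) (q := y) (α := Real.sinh (d + r) / Real.sinh d)
    (β := -(Real.sinh r / Real.sinh d)) (by
      rw [hc, Real.sinh_add]
      field_simp
      linear_combination (Real.sinh d ^ 2) * h2 - Real.sinh r ^ 2 * h1)
    (by rw [e1]; exact Real.cosh_pos r)
  refine ⟨z, _, _, div_nonneg (Real.sinh_nonneg_iff.2 (by positivity)) hs.le, hz, ?_, ?_⟩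
  · refine Real.cosh_injOn (Set.mem_Ici.2 dist_nonneg) (Set.mem_Ici.2 hr) ?_
    rw [cosh_dist, hz.form_left, form_self, mul_one, form_comm y x, e1]
  · refine Real.cosh_injOn (Set.mem_Ici.2 dist_nonneg) (Set.mem_Ici.2 (by positivity)) ?_
    rw [cosh_dist, hz.form_left, form_self, mul_one, hc, Real.sinh_add, Real.cosh_add]
    field_simp
    linear_combination Real.sinh r * h1

/-! ### Half-spaces -/

/-- The Cauchy-Schwarz inequality, on the orthogonal complement of the point `v`, for the components
of an arbitrary Minkowski vector `(τ, a)` and of a point `w`. -/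
lemma sq_sub_le (τ : ℝ) (a : EuclideanSpace ℝ (Fin n)) (v w : HyperbolicSpace n) :
    (τ * w.time - inner ℝ a w.space - (τ * v.time - inner ℝ a v.space) * form v w) ^ 2 ≤
      (‖a‖ ^ 2 - τ ^ 2 + (τ * v.time - inner ℝ a v.space) ^ 2) * (form v w ^ 2 - 1) := by
  have hv := v.sheet
  have hw := w.sheet
  set m := τ * v.time - inner ℝ a v.space with hm
  have e1 : inner ℝ a v.space = τ * v.time - m := by rw [hm]; ring
  have e2 : inner ℝ v.space w.space = v.time * w.time - form v w := by unfold form; ring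
  have e2' : inner ℝ w.space v.space = v.time * w.time - form v w := by
    rw [real_inner_comm]; exact e2
  have h := cauchy_of_orthogonal v (τ - m * v.time) (w.time - form v w * v.time)
    (a - m • v.space) (w.space - form v w • v.space)
    (by
      rw [inner_sub_left, real_inner_smul_left, real_inner_self_eq_norm_sq, e1]
      linear_combination (-m) * hv)
    (by
      rw [inner_sub_left, real_inner_smul_left, real_inner_self_eq_norm_sq, e2']
      linear_combination (-form v w) * hv)
  have f1 : inner ℝ (a - m • v.space) (w.space - form v w • v.space)
      - (τ - m * v.time) * (w.time - form v w * v.time)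
      = -(τ * w.time - inner ℝ a w.space - m * form v w) := by
    simp only [inner_sub_left, inner_sub_right, real_inner_smul_left, real_inner_smul_right,
      real_inner_self_eq_norm_sq, e1, e2]
    linear_combination (-m * form v w) * hv
  have f2 : ‖a - m • v.space‖ ^ 2 - (τ - m * v.time) ^ 2 = ‖a‖ ^ 2 - τ ^ 2 + m ^ 2 := by
    rw [norm_sub_sq_real, real_inner_smul_right, norm_smul, mul_pow, Real.norm_eq_abs, sq_abs, e1]
    linear_combination (-m ^ 2) * hv
  have f3 : ‖w.space - form v w • v.space‖ ^ 2 - (w.time - form v w * v.time) ^ 2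
      = form v w ^ 2 - 1 := by
    rw [norm_sub_sq_real, real_inner_smul_right, norm_smul, mul_pow, Real.norm_eq_abs, sq_abs, e2']
    linear_combination (-1) * hw - form v w ^ 2 * hv
  rw [f1, f2, f3, neg_sq] at h
  exact h

/-- The functional `w ↦ form x y * form y w - form x w` is `sinh (dist x y)` times the hyperbolic
sine of the signed distance from `w` to the hyperplane through `y` orthogonal to the geodesic from `y` to
`x`. Hence, at a point `p` whose distance to some point `p'` of the negative half-space is at most
`ρ`, it is at most `sinh (dist x y) * sinh ρ`. -/
lemma form_mul_form_sub_le {x y p p' : HyperbolicSpace n} {ρ : ℝ}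
    (hp' : form x y * form y p' ≤ form x p') (hp : dist p' p ≤ ρ) :
    form x y * form y p - form x p ≤ Real.sinh (dist x y) * Real.sinh ρ := by
  have hρ : 0 ≤ ρ := dist_nonneg.trans hp
  have hs : 0 ≤ Real.sinh (dist x y) := Real.sinh_nonneg_iff.2 dist_nonneg
  have hsρ : 0 ≤ Real.sinh (dist p' p) := Real.sinh_nonneg_iff.2 dist_nonneg
  have hmono : Real.sinh (dist p' p) ≤ Real.sinh ρ := Real.sinh_le_sinh.2 hp
  refine le_trans ?_ (mul_le_mul_of_nonneg_left hmono hs)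
  rcases le_or_gt (form x y * form y p - form x p) 0 with hl | hl
  · exact hl.trans (by positivity)
  have h := sq_sub_le (form x y * y.time - x.time) (form x y • y.space - x.space) p' p
  have e : ∀ w : HyperbolicSpace n, (form x y * y.time - x.time) * w.time
      - inner ℝ (form x y • y.space - x.space) w.space = form x y * form y w - form x w := by
    intro w
    simp only [form, inner_sub_left, real_inner_smul_left]
    ring
  have e2 : ‖form x y • y.space - x.space‖ ^ 2 - (form x y * y.time - x.time) ^ 2
      = Real.sinh (dist x y) ^ 2 := by
    have e3 : inner ℝ y.space x.space = x.time * y.time - form x y := by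
      unfold form; rw [real_inner_comm]; ring
    rw [norm_sub_sq_real, real_inner_smul_left, norm_smul, mul_pow, Real.norm_eq_abs, sq_abs, e3,
      Real.sinh_sq, cosh_dist]
    linear_combination (-form x y ^ 2) * y.sheet - x.sheet
  rw [e, e, e2, ← cosh_dist p' p] at h
  have hk := Real.cosh_sq (dist p' p)
  have hk0 := Real.cosh_pos (dist p' p)
  refine le_of_sq_le_sq ?_ (by positivity)
  set l := form x y * form y p - form x p
  set m := form x p' - form x y * form y p' with hm
  have hm0 : 0 ≤ m := sub_nonneg.2 hp'
  have hm' : form x y * form y p' - form x p' = -m := by rw [hm]; ring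
  rw [hm', hk] at h
  have h5 : 0 ≤ l * m * Real.cosh (dist p' p) := by positivity
  have : (m * Real.cosh (dist p' p)) ^ 2 = m ^ 2 * (Real.sinh (dist p' p) ^ 2 + 1) := by
    rw [mul_pow, hk]
  nlinarith [sq_nonneg m]

/-! ### Boundaries of convex sets are null -/

lemma continuous_form_left (q : HyperbolicSpace n) : Continuous fun p => form p q := by
  simp only [← cosh_dist]
  fun_prop

lemma continuous_space : Continuous (space : HyperbolicSpace n → EuclideanSpace ℝ (Fin n)) := by
  have ht : Continuous (time : HyperbolicSpace n → ℝ) := by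
    have : (time : HyperbolicSpace n → ℝ) = fun p => form p (ofSpace 0) := by
      ext p
      simp [form, ofSpace]
    rw [this]
    exact continuous_form_left _
  have hi : ∀ i, Continuous fun p : HyperbolicSpace n => p.space i := by
    intro i
    have : (fun p : HyperbolicSpace n => p.space i) = fun p =>
        p.time * (ofSpace (EuclideanSpace.single i (1 : ℝ))).time
          - form p (ofSpace (EuclideanSpace.single i 1)) := by
      ext p
      simp [form, ofSpace, EuclideanSpace.inner_single_right]
    rw [this]
    exact (ht.mul continuous_const).sub (continuous_form_left _)
  exact (PiLp.continuous_toLp 2 _).comp (continuous_pi hi)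

/-- The global chart as a homeomorphism. -/
noncomputable def ofSpaceHomeomorph (n : ℕ) : EuclideanSpace ℝ (Fin n) ≃ₜ HyperbolicSpace n where
  toFun := ofSpace
  invFun := space
  left_inv _ := rfl
  right_inv := ofSpace_space
  continuous_toFun := continuous_ofSpace
  continuous_invFun := continuous_space

open OpenPartialHomeomorph in
/-- The boundary of a convex set has volume zero: the map `(t, x) ↦ x / t` to the Klein model turns
geodesic segments into Euclidean ones, and Euclidean convex sets have null boundary. -/
lemma vol_frontier_eq_zero {S : Set (HyperbolicSpace n)}
    (hS : ∀ p ∈ S, ∀ q ∈ S, ∀ α β z, 0 ≤ α → 0 ≤ β → IsComb α β p q z → z ∈ S) :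
    vol n (frontier S) = 0 := by
  let φ : OpenPartialHomeomorph (EuclideanSpace ℝ (Fin n)) (EuclideanSpace ℝ (Fin n)) :=
    univUnitBall
  have hφ : ∀ x, φ x = (ofSpace x).time⁻¹ • x := fun x => univUnitBall_apply x
  have hball : ∀ x, φ x ∈ Metric.ball (0 : EuclideanSpace ℝ (Fin n)) 1 := fun x =>
    φ.map_source (Set.mem_univ x)
  set A : Set (EuclideanSpace ℝ (Fin n)) := ofSpace ⁻¹' S with hA
  have hconv : Convex ℝ (φ '' A) := by
    rintro _ ⟨x, hx, rfl⟩ _ ⟨y, hy, rfl⟩ a b ha hb hab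
    have hu := convex_ball 0 1 (hball x) (hball y) ha hb hab
    refine ⟨φ.symm (a • φ x + b • φ y), ?_, φ.right_inv hu⟩
    have hz := φ.right_inv hu
    set w := φ.symm (a • φ x + b • φ y)
    have hx0 := (ofSpace x).time_pos
    have hy0 := (ofSpace y).time_pos
    have hw0 := (ofSpace w).time_pos
    refine hS _ hx _ hy ((ofSpace w).time * a * (ofSpace x).time⁻¹)
      ((ofSpace w).time * b * (ofSpace y).time⁻¹) _ (by positivity) (by positivity) ⟨?_, ?_⟩
    · field_simp
      rw [hab]
    · rw [hφ, hφ, hφ, inv_smul_eq_iff₀ hw0.ne'] at hz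
      refine hz.trans ?_
      simp only [smul_add, smul_smul, mul_assoc]
      rfl
  have hfr : frontier A ⊆ φ.symm '' (frontier (φ '' A) ∩ Metric.ball 0 1) := by
    intro x hx
    refine ⟨φ x, ⟨?_, hball x⟩, φ.left_inv (Set.mem_univ x)⟩
    have hi : φ.IsImage A (φ '' A) := by
      intro z _
      exact φ.injOn.mem_image_iff (Set.subset_univ _) (Set.mem_univ z)
    exact (hi.frontier.apply_mem_iff (Set.mem_univ x)).2 hx
  have hnull : volume (frontier A) = 0 := by
    refine measure_mono_null hfr (addHaar_image_eq_zero_of_differentiableOn_of_addHaar_eq_zero _ ?_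
      (measure_mono_null Set.inter_subset_left (hconv.addHaar_frontier _)))
    exact (contDiffOn_univUnitBall_symm (n := 1).differentiableOn one_ne_zero).mono
      Set.inter_subset_right
  have hpre : ofSpace ⁻¹' frontier S = frontier A := (ofSpaceHomeomorph n).preimage_frontier S
  unfold vol
  rw [Measure.map_apply continuous_ofSpace.measurable isClosed_frontier.measurableSet, hpre]
  exact withDensity_absolutelyContinuous _ _ hnull

end HyperbolicSpace

namespace HypConvexBody

open HyperbolicSpace Metric

variable {n : ℕ} (K : HypConvexBody n)

/-! ### Nearest points -/

lemma cosh_infDist (x : HyperbolicSpace n) :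
    Real.cosh (infDist x K.carrier) = form x (K.proj x) := by
  rw [← K.dist_proj, dist_comm, cosh_dist]

lemma ne_proj {x : HyperbolicSpace n} (hx : x ∉ K.carrier) : x ≠ K.proj x :=
  fun h => hx (h ▸ K.proj_mem x)

/-- The angle at the nearest point `proj x` between `x` and any point `w` of `K` is at least
`π / 2`, so that `cosh d(x, w) ≥ cosh d(x, proj x) * cosh d(proj x, w)`. -/
lemma form_proj_mul_form_le (x : HyperbolicSpace n) {w : HyperbolicSpace n}
    (hw : w ∈ K.carrier) : form x (K.proj x) * form (K.proj x) w ≤ form x w := by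
  set y := K.proj x with hy
  have hc := form_pos x y
  have hk := form_pos y w
  -- moving from `y` towards `w` does not decrease the distance to `x`
  have key : ∀ ε > 0, ε * (form x y ^ 2 - form x w ^ 2)
      ≤ 2 * form x y * (form x w - form x y * form y w) := by
    intro ε hε
    set N := √(1 + 2 * ε * form y w + ε ^ 2) with hN
    have hN2 : N ^ 2 = 1 + 2 * ε * form y w + ε ^ 2 := Real.sq_sqrt (by positivity)
    have hN0 : 0 < N := Real.sqrt_pos.2 (by positivity)
    obtain ⟨z, hz⟩ := exists_isComb (p := y) (q := w) (α := 1 / N) (β := ε / N)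
      (by field_simp; linear_combination -hN2) (by positivity)
    have hzK := K.convex.mem_of_isComb (K.proj_mem x) hw hz (by positivity) (by positivity)
    have h1 : form x y ≤ form x z := by
      rw [hy, ← K.cosh_infDist, ← cosh_dist, Real.cosh_le_cosh, abs_of_nonneg infDist_nonneg,
        abs_of_nonneg dist_nonneg]
      exact infDist_le_dist_of_mem hzK
    rw [hz.form_right] at h1
    have h2 : form x y * N ≤ form x y + ε * form x w := by
      have h3 := mul_le_mul_of_nonneg_right h1 hN0.le
      have h4 : (1 / N * form x y + ε / N * form x w) * N = form x y + ε * form x w := by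
        field_simp
      linarith
    have h5 : (form x y * N) ^ 2 ≤ (form x y + ε * form x w) ^ 2 :=
      pow_le_pow_left₀ (by positivity) h2 2
    rw [mul_pow, hN2] at h5
    refine le_of_mul_le_mul_left ?_ hε
    linarith
  have hlim : Tendsto (fun ε : ℝ => ε * (form x y ^ 2 - form x w ^ 2)) (𝓝[>] 0) (𝓝 0) := by
    have : Tendsto (fun ε : ℝ => ε * (form x y ^ 2 - form x w ^ 2)) (𝓝 0)
        (𝓝 (0 * (form x y ^ 2 - form x w ^ 2))) := tendsto_id.mul_const _
    rw [zero_mul] at this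
    exact this.mono_left nhdsWithin_le_nhds
  have h := le_of_tendsto hlim (eventually_nhdsWithin_of_forall key)
  exact sub_nonneg.1 (nonneg_of_mul_nonneg_right h (by positivity))

/-- Starting outside `K`, one can move away from `K` at unit speed. -/
lemma exists_dist_eq_add_le_infDist {x : HyperbolicSpace n} (hx : x ∉ K.carrier) {r : ℝ}
    (hr : 0 ≤ r) : ∃ z, dist z x = r ∧ infDist x K.carrier + r ≤ infDist z K.carrier := by
  obtain ⟨z, α, β, hα, hz, hzx, hzy⟩ := exists_prolongation (K.ne_proj hx) hr
  refine ⟨z, hzx, (le_infDist K.nonempty).2 fun w hw => ?_⟩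
  rw [← K.dist_proj, dist_comm _ x, ← hzy, ← abs_of_nonneg (dist_nonneg (x := z) (y := w)),
    ← abs_of_nonneg (dist_nonneg (x := z) (y := K.proj x)), ← Real.cosh_le_cosh, cosh_dist,
    cosh_dist]
  have h1 := K.form_proj_mul_form_le x hw
  have h2 := one_le_form (K.proj x) w
  have h3 := form_pos z (K.proj x)
  calc form z (K.proj x) ≤ form z (K.proj x) * form (K.proj x) w := le_mul_of_one_le_right h3.le h2
    _ = α * (form x (K.proj x) * form (K.proj x) w) + β * form (K.proj x) w := by
      rw [hz.form_left, form_self]; ring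
    _ ≤ α * form x w + β * form (K.proj x) w := by gcongr
    _ = form z w := (hz.form_left w).symm

lemma proj_mem_frontier {x : HyperbolicSpace n} (hx : x ∉ K.carrier) :
    K.proj x ∈ frontier K.carrier := by
  set y := K.proj x with hy
  have hxy : 0 < dist x y := dist_pos.2 (K.ne_proj hx)
  -- the points of the geodesic from `x` to `y` that bisect it repeatedly, converging to `y`
  let m : ℕ → HyperbolicSpace n := fun k => k.rec x fun _ p => midpt p y
  have hm : ∀ k, dist (m k) y = dist x y / 2 ^ k ∧ dist x (m k) ≤ dist x y - dist x y / 2 ^ k := by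
    intro k
    induction k with
    | zero => simp [m]
    | succ k ih =>
      have h1 : dist (m (k + 1)) y = dist (m k) y / 2 := dist_midpt_right _ _
      have h2 : dist (m k) (m (k + 1)) = dist (m k) y / 2 := dist_midpt_left _ _
      have h3 := dist_triangle x (m k) (m (k + 1))
      rw [h1, ih.1, pow_succ]
      rw [h2, ih.1] at h3
      refine ⟨by ring, h3.trans ?_⟩
      have h4 : dist x y / (2 ^ k * 2) = dist x y / 2 ^ k / 2 := by ring
      rw [h4]
      linarith [ih.2]
  have hlim : Tendsto m atTop (𝓝 y) := by
    rw [tendsto_iff_dist_tendsto_zero]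
    simp only [fun k => (hm k).1]
    have h := (tendsto_pow_atTop_nhds_zero_of_lt_one (r := (1 / 2 : ℝ)) (by norm_num)
      (by norm_num)).const_mul (dist x y)
    simpa [div_eq_mul_inv] using h
  refine ⟨subset_closure (K.proj_mem x), fun hint => ?_⟩
  obtain ⟨k, hk⟩ := (hlim.eventually (isOpen_interior.mem_nhds hint)).exists
  have h1 := infDist_le_dist_of_mem (x := x) (interior_subset hk)
  rw [← K.dist_proj, dist_comm, ← hy] at h1
  have h2 : 0 < dist x y / 2 ^ k := by positivity
  linarith [(hm k).2]

lemma infDist_pos {x : HyperbolicSpace n} (hx : x ∉ K.carrier) : 0 < infDist x K.carrier :=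
  (K.isCompact.isClosed.notMem_iff_infDist_pos K.nonempty).1 hx

/-! ### Parallel bodies and their null boundaries -/

/-- The parallel body of a convex body is convex. If `d(z, K) > ρ`, the functional of
`form_mul_form_sub_le` with base points `z` and `proj z` is nonpositive on `K`, at most
`sinh d(z, K) * sinh ρ` on the parallel body, and equal to `sinh d(z, K) ^ 2` at `z`. -/
lemma infDist_le_of_isComb {ρ α β : ℝ} {p q z : HyperbolicSpace n}
    (hp : infDist p K.carrier ≤ ρ) (hq : infDist q K.carrier ≤ ρ) (h : IsComb α β p q z)
    (hα : 0 ≤ α) (hβ : 0 ≤ β) : infDist z K.carrier ≤ ρ := by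
  have hρ : 0 ≤ ρ := infDist_nonneg.trans hp
  by_contra! hlt
  have hz0 : 0 < dist z (K.proj z) := by
    rw [dist_comm, K.dist_proj]; exact hρ.trans_lt hlt
  have hs : 0 < Real.sinh (dist z (K.proj z)) := Real.sinh_pos_iff.2 hz0
  have hsρ : 0 ≤ Real.sinh ρ := Real.sinh_nonneg_iff.2 hρ
  have hlt' : Real.sinh ρ < Real.sinh (dist z (K.proj z)) := by
    rw [Real.sinh_lt_sinh, dist_comm, K.dist_proj]; exact hlt
  have bound : ∀ w, infDist w K.carrier ≤ ρ →
      form z (K.proj z) * form (K.proj z) w - form z w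
        ≤ Real.sinh (dist z (K.proj z)) * Real.sinh ρ := fun w hw =>
    form_mul_form_sub_le (K.form_proj_mul_form_le z (K.proj_mem w)) ((K.dist_proj w).trans_le hw)
  have h1 : form z (K.proj z) * form (K.proj z) z - form z z
      = Real.sinh (dist z (K.proj z)) ^ 2 := by
    rw [Real.sinh_sq, cosh_dist, form_self, form_comm (K.proj z) z]; ring
  have h2 := h.add_le_one hα hβ
  have h3 := mul_le_mul_of_nonneg_left (bound p hp) hα
  have h4 := mul_le_mul_of_nonneg_left (bound q hq) hβ
  have h5 : form z (K.proj z) * form (K.proj z) z - form z z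
      = α * (form z (K.proj z) * form (K.proj z) p - form z p)
        + β * (form z (K.proj z) * form (K.proj z) q - form z q) := by
    rw [h.form_right (K.proj z), h.form_right z]; ring
  have h6 : (α + β) * (Real.sinh (dist z (K.proj z)) * Real.sinh ρ)
      ≤ 1 * (Real.sinh (dist z (K.proj z)) * Real.sinh ρ) :=
    mul_le_mul_of_nonneg_right h2 (by positivity)
  nlinarith

lemma vol_frontier : vol n (frontier K.carrier) = 0 :=
  vol_frontier_eq_zero fun _ hp _ hq _ _ _ hα hβ h => K.convex.mem_of_isComb hp hq h hα hβ

lemma vol_infDist_eq {ρ : ℝ} (hρ : 0 < ρ) : vol n {x | infDist x K.carrier = ρ} = 0 := by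
  refine measure_mono_null ?_ (vol_frontier_eq_zero (S := {x | infDist x K.carrier ≤ ρ})
    fun _ hp _ hq _ _ _ hα hβ h => K.infDist_le_of_isComb hp hq h hα hβ)
  intro x hx
  have hx' : infDist x K.carrier = ρ := hx
  refine ⟨subset_closure hx'.le, fun hint => ?_⟩
  obtain ⟨ε, hε, hball⟩ := Metric.isOpen_iff.1 isOpen_interior x hint
  have hxK : x ∉ K.carrier := fun h => by
    rw [infDist_zero_of_mem h] at hx'; exact hρ.ne hx'
  obtain ⟨z, hzx, hz⟩ := K.exists_dist_eq_add_le_infDist hxK (half_pos hε).le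
  have h1 : infDist z K.carrier ≤ ρ :=
    interior_subset (s := {x | infDist x K.carrier ≤ ρ})
      (hball (mem_ball.2 (by rw [hzx]; exact half_lt_self hε)))
  linarith

/-! ### The measure as the image of a shell -/

/-- Nearest points to points outside `K` automatically lie on the boundary, so `μ_ρ(K, ·)` is the
image under the projection of the volume of the parallel shell. -/
lemma parallelMeasure_eq_map (ρ : ℝ) : K.parallelMeasure ρ =
    ((vol n).restrict ({x | infDist x K.carrier ≤ ρ} \ K.carrier)).map K.proj := by
  ext β hβ
  rw [K.parallelMeasure_apply ρ hβ, Measure.map_apply K.continuous_proj.measurable hβ,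
    Measure.restrict_apply (K.continuous_proj.measurable hβ)]
  congr 1
  ext x
  simp only [localParallelSet, Set.mem_inter_iff, Set.mem_preimage, Set.mem_sdiff]
  exact ⟨fun h => ⟨h.1.1, h.2⟩, fun h => ⟨⟨h.1, K.proj_mem_frontier h.2.2⟩, h.2⟩⟩

lemma measurableSet_shell (ρ : ℝ) :
    MeasurableSet ({x | infDist x K.carrier ≤ ρ} \ K.carrier) :=
  (isClosed_le (continuous_infDist_pt _) continuous_const).measurableSet.diff
    K.isCompact.isClosed.measurableSet

lemma integral_parallelMeasure (ρ : ℝ) {g : HyperbolicSpace n → ℝ} (hg : Continuous g) :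
    ∫ x, g x ∂K.parallelMeasure ρ =
      ∫ x, ({x | infDist x K.carrier ≤ ρ} \ K.carrier).indicator (fun x => g (K.proj x)) x
        ∂vol n := by
  rw [K.parallelMeasure_eq_map, integral_map K.continuous_proj.measurable.aemeasurable
    hg.measurable.aestronglyMeasurable, integral_indicator (K.measurableSet_shell ρ)]

/-! ### Hausdorff convergence -/

lemma hausdorffEDist_ne_top (K L : HypConvexBody n) :
    hausdorffEDist K.carrier L.carrier ≠ ⊤ :=
  hausdorffEDist_ne_top_of_nonempty_of_bounded K.nonempty L.nonempty K.isCompact.isBounded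
    L.isCompact.isBounded

lemma abs_infDist_sub_le (K L : HypConvexBody n) (x : HyperbolicSpace n) :
    |infDist x K.carrier - infDist x L.carrier| ≤ hausdorffDist K.carrier L.carrier := by
  have h1 := infDist_le_infDist_add_hausdorffDist (x := x) (hausdorffEDist_ne_top K L)
  have h2 := infDist_le_infDist_add_hausdorffDist (x := x) (hausdorffEDist_ne_top L K)
  rw [hausdorffDist_comm] at h2
  rw [abs_le]
  constructor <;> linarith

/-- A convex body misses no point that lies deeper in `L` than its Hausdorff distance to `L`. -/
lemma mem_of_closedBall_subset {L : HypConvexBody n} {x : HyperbolicSpace n} {r : ℝ}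
    (hball : closedBall x r ⊆ L.carrier) (hr : hausdorffDist K.carrier L.carrier ≤ r) :
    x ∈ K.carrier := by
  by_contra hx
  obtain ⟨z, hzx, hz⟩ := K.exists_dist_eq_add_le_infDist hx (hausdorffDist_nonneg.trans hr)
  have h1 := abs_le.1 (abs_infDist_sub_le K L z)
  rw [infDist_zero_of_mem (hball (mem_closedBall.2 hzx.le))] at h1
  linarith [K.infDist_pos hx]

section Convergence

variable {K : ℕ → HypConvexBody n} {K₀ : HypConvexBody n}

lemma tendsto_infDist
    (hK : Tendsto (fun j => hausdorffDist (K j).carrier K₀.carrier) atTop (𝓝 0))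
    (x : HyperbolicSpace n) :
    Tendsto (fun j => infDist x (K j).carrier) atTop (𝓝 (infDist x K₀.carrier)) := by
  rw [tendsto_iff_dist_tendsto_zero]
  exact squeeze_zero (fun _ => dist_nonneg) (fun j => abs_infDist_sub_le (K j) K₀ x) hK

/-- Let `w j ∈ K j` converge to `proj x ∈ K₀`. By the obtuse angle inequality,
`cosh d(proj_j x, w j) ≤ cosh d(x, w j) / cosh d(x, K j)`, and the right-hand side tends to `1`. -/
lemma tendsto_proj
    (hK : Tendsto (fun j => hausdorffDist (K j).carrier K₀.carrier) atTop (𝓝 0))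
    (x : HyperbolicSpace n) :
    Tendsto (fun j => (K j).proj x) atTop (𝓝 (K₀.proj x)) := by
  set w : ℕ → HyperbolicSpace n := fun j => (K j).proj (K₀.proj x) with hw
  have hw_lim : Tendsto w atTop (𝓝 (K₀.proj x)) := by
    have h := tendsto_infDist hK (K₀.proj x)
    rw [infDist_zero_of_mem (K₀.proj_mem x)] at h
    rw [tendsto_iff_dist_tendsto_zero]
    exact h.congr fun j => ((K j).dist_proj _).symm
  have hden : Tendsto (fun j => form x ((K j).proj x)) atTop (𝓝 (form x (K₀.proj x))) := by
    simp only [← cosh_infDist]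
    exact (Real.continuous_cosh.tendsto _).comp (tendsto_infDist hK x)
  have hnum : Tendsto (fun j => form x (w j)) atTop (𝓝 (form x (K₀.proj x))) := by
    simp only [form_comm x]
    exact ((continuous_form_left x).tendsto _).comp hw_lim
  have hquot := hnum.div hden (form_pos x (K₀.proj x)).ne'
  rw [div_self (form_pos x (K₀.proj x)).ne'] at hquot
  have hform : Tendsto (fun j => form ((K j).proj x) (w j)) atTop (𝓝 1) := by
    refine tendsto_of_tendsto_of_tendsto_of_le_of_le tendsto_const_nhds hquot
      (fun j => one_le_form _ _) fun j => ?_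
    change _ ≤ form x (w j) / form x ((K j).proj x)
    rw [le_div_iff₀ (form_pos _ _), mul_comm]
    exact (K j).form_proj_mul_form_le x ((K j).proj_mem _)
  have hdist : Tendsto (fun j => dist ((K j).proj x) (w j)) atTop (𝓝 0) := by
    have hcont : ContinuousAt Real.arcosh 1 := by
      unfold Real.arcosh
      exact ContinuousAt.log (by fun_prop) (by simp)
    have h := hcont.tendsto.comp hform
    rwa [show Real.arcosh 1 = 0 by simp] at h
  exact hw_lim.congr_dist (by simpa only [dist_comm] using hdist)

lemma eventually_mem_of_mem_interior
    (hK : Tendsto (fun j => hausdorffDist (K j).carrier K₀.carrier) atTop (𝓝 0))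
    {x : HyperbolicSpace n} (hx : x ∈ interior K₀.carrier) :
    ∀ᶠ j in atTop, x ∈ (K j).carrier := by
  obtain ⟨r, hr, hball⟩ := nhds_basis_closedBall.mem_iff.1 (mem_interior_iff_mem_nhds.1 hx)
  filter_upwards [hK.eventually_le_const hr] with j hj
  exact (K j).mem_of_closedBall_subset hball hj

lemma tendsto_indicator_shell
    (hK : Tendsto (fun j => hausdorffDist (K j).carrier K₀.carrier) atTop (𝓝 0))
    {ρ : ℝ} {g : HyperbolicSpace n → ℝ} (hg : Continuous g)
    {x : HyperbolicSpace n} (hx : x ∉ frontier K₀.carrier) (hxρ : infDist x K₀.carrier ≠ ρ) :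
    Tendsto (fun j => ({x | infDist x (K j).carrier ≤ ρ} \ (K j).carrier).indicator
        (fun x => g ((K j).proj x)) x) atTop
      (𝓝 (({x | infDist x K₀.carrier ≤ ρ} \ K₀.carrier).indicator
        (fun x => g (K₀.proj x)) x)) := by
  have hlim := tendsto_infDist hK x
  by_cases hxK : x ∈ K₀.carrier
  · have hint : x ∈ interior K₀.carrier := by
      by_contra h
      exact hx ⟨subset_closure hxK, h⟩
    rw [Set.indicator_of_notMem fun h => h.2 hxK]
    refine tendsto_const_nhds.congr' ?_
    filter_upwards [eventually_mem_of_mem_interior hK hint] with j hj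
    rw [Set.indicator_of_notMem fun h => h.2 hj]
  rcases lt_or_gt_of_ne hxρ with hlt | hgt
  · rw [Set.indicator_of_mem (show x ∈ _ \ _ from ⟨hlt.le, hxK⟩)]
    refine ((hg.tendsto _).comp (tendsto_proj hK x)).congr' ?_
    filter_upwards [hlim.eventually_le_const hlt, hlim.eventually_const_lt (K₀.infDist_pos hxK)]
      with j hj hj'
    rw [Set.indicator_of_mem]
    · rfl
    · exact ⟨hj, fun h => hj'.ne' (infDist_zero_of_mem h)⟩
  · rw [Set.indicator_of_notMem fun h => hgt.not_ge h.1]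
    refine tendsto_const_nhds.congr' ?_
    filter_upwards [hlim.eventually_const_lt hgt] with j hj
    rw [Set.indicator_of_notMem fun h => hj.not_ge h.1]

end Convergence

end HypConvexBody

theorem proposition2p3 (n : ℕ) (K : ℕ → HypConvexBody n) (K₀ : HypConvexBody n)
    (hK : Tendsto (fun j => Metric.hausdorffDist (K j).carrier K₀.carrier) atTop (𝓝 0))
    (ρ : ℝ) (hρ : 0 < ρ) :
    Tendsto (fun j => (K j).mu ρ) atTop (𝓝 (K₀.mu ρ)) := by
  rw [FiniteMeasure.tendsto_iff_forall_integral_tendsto]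
  intro g
  change Tendsto (fun j => ∫ x, g x ∂(K j).parallelMeasure ρ) atTop
    (𝓝 (∫ x, g x ∂K₀.parallelMeasure ρ))
  simp only [HypConvexBody.integral_parallelMeasure _ ρ g.continuous]
  -- for large `j`, every shell lies in the bounded neighbourhood `B` of `K₀`
  set B : Set (HyperbolicSpace n) := {x | Metric.infDist x K₀.carrier ≤ ρ + 1} with hB
  have hBm : MeasurableSet B :=
    (isClosed_le (Metric.continuous_infDist_pt _) continuous_const).measurableSet
  have hBvol : HyperbolicSpace.vol n B < ∞ := by
    refine HyperbolicSpace.vol_lt_top_of_isBounded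
      ((K₀.isCompact.isBounded.cthickening (δ := ρ + 1)).subset fun x hx => ?_)
    exact Metric.mem_cthickening_of_dist_le x (K₀.proj x) _ _ (K₀.proj_mem x)
      (by rw [dist_comm, K₀.dist_proj]; exact hx)
  refine tendsto_integral_filter_of_dominated_convergence (B.indicator fun _ => ‖g‖) ?_ ?_ ?_ ?_
  · refine Eventually.of_forall fun j => Measurable.aestronglyMeasurable ?_
    exact (g.continuous.comp (K j).continuous_proj).measurable.indicator
      ((K j).measurableSet_shell ρ)
  · filter_upwards [hK.eventually_le_const one_pos] with j hj
    refine Eventually.of_forall fun x => ?_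
    by_cases hx : x ∈ {x | Metric.infDist x (K j).carrier ≤ ρ} \ (K j).carrier
    · have hxB : x ∈ B := by
        have h1 := abs_le.1 (HypConvexBody.abs_infDist_sub_le (K j) K₀ x)
        have h2 : Metric.infDist x (K j).carrier ≤ ρ := hx.1
        change Metric.infDist x K₀.carrier ≤ ρ + 1
        linarith
      rw [Set.indicator_of_mem hx, Set.indicator_of_mem hxB]
      exact g.norm_coe_le_norm _
    · rw [Set.indicator_of_notMem hx, norm_zero]
      exact Set.indicator_nonneg (fun _ _ => norm_nonneg g) x
  · exact (integrable_indicator_iff hBm).2 (integrableOn_const hBvol.ne)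
  · have h1 : ∀ᵐ x ∂HyperbolicSpace.vol n, x ∉ frontier K₀.carrier :=
      measure_eq_zero_iff_ae_notMem.1 K₀.vol_frontier
    have h2 : ∀ᵐ x ∂HyperbolicSpace.vol n, x ∉ {x | Metric.infDist x K₀.carrier = ρ} :=
      measure_eq_zero_iff_ae_notMem.1 (K₀.vol_infDist_eq hρ)
    filter_upwards [h1, h2] with x hx hxρ
    exact HypConvexBody.tendsto_indicator_shell hK g.continuous hx hxρ
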